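/- \textbf{Setting.} Let $P$ be a probability distribution on a measurable space $\mathcal X$ and let $X_1,X_2,\dots$ be i.i.d. with law $P$. Let $H_1,\dots,H_s$ be hypotheses, $H_i$ being a set of probability distributions on $\mathcal X$, and let $I(P)=\{i : P\in H_i\}$ be the set of indices of true hypotheses. For every $n$ and $i$ let $T_{n,i}=T_{n,i}(X_1,\dots,X_n)$ be a real-valued (measurable) test statistic. Fix an integer $k\ge 1$ and $\alpha\in(0,1)$. For $|K|\ge k$, $k\text{-}\max(y_i:i\in K)$ denotes the $k$-th largest of the numbers $y_i$, $i\in K$. Let $G_{n,K}(P)$ be the joint distribution of $(T_{n,i}:i\in K)$. \textbf{Assumption S.} $G_{n,I(P)}(P)$ converges weakly to a probability distribution $G_{I(P)}$ on $\mathbb R^{|I(P)|}$. Moreover, if $|I(P)|\ge k$, let $H_{I(P)}(x,k)$ be the c.d.f. of $k\text{-}\max(T_i:i\in I(P))$ when $(T_i)_{i\in I(P)}\sim G_{I(P)}$, and let $c_{I(P)}(1-\alpha,k)=\inf\{x: H_{I(P)}(x,k)\ge 1-\alpha\}$; then $H_{I(P)}(\cdot,k)$ is continuous and strictly increasing at $c=c_{I(P)}(1-\alpha,k)$,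 the latter meaning $H_{I(P)}(x,k)<H_{I(P)}(c,k)<H_{I(P)}(y,k)$ for all $x<c<y$. \textbf{Subsampling.} Let $b=b_n$ be positive integers. For each of the $N_n=\binom nb$ subsets $a$ of $\{1,\dots,n\}$ of size $b$ let $T_{b,i}^{(a)}$ be the statistic $T_{b,i}$ evaluated at $(X_j: j\in a)$, taken in increasing order of $j$. Let $\hat G_{n,K}$ be the empirical distribution of the $N_n$ vectors $(T_{b,i}^{(a)}:i\in K)$, and $$\hat H_{n,K}(x,k)=\frac1{N_n}\sum_a \mathbf 1\{k\text{-}\max(T^{(a)}_{b,i}:i\in K)\le x\},\qquad \hat c_{n,K}(1-\alpha,k)=\inf\{x:\hat H_{n,K}(x,k)\ge 1-\alpha\}.$$ \textbf{Step-down method.} First reject every $H_i$ with $T_{n,i}>\hat c_{n,\{1,\dots,s\}}(1-\alpha,k)$. Then repeat: let $R$ be the set of indices rejected so far and $A$ its complement. If $|R|<k$, stop. Otherwise reject every $H_i$, $i\in A$, with $T_{n,i}>\max\{\hat c_{n,A\cup I}(1-\alpha,k): I\subset R,\ |I|=k-1\}$; if there are no further rejections, stop. Let $k\text{-FWER}_P$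 be the probability that at least $k$ of the hypotheses $H_i$, $i\in I(P)$, are rejected. \textbf{Theorem.} Suppose Assumption S holds, $b\to\infty$ and $b/n\to0$ as $n\to\infty$. Then: (i) for every metric $\rho$ metrizing weak convergence of probability distributions on $\mathbb R^{|I(P)|}$, $\rho(\hat G_{n,I(P)},G_{n,I(P)}(P))\to0$ in probability; (ii) if $|I(P)|\ge k$, then $\hat c_{n,I(P)}(1-\alpha,k)\to c_{I(P)}(1-\alpha,k)$ in probability; (iii) $\limsup_n k\text{-FWER}_P\le\alpha$ for the step-down method above. -/

import Mathlib

open MeasureTheory ProbabilityTheory Filter Topology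
open scoped ENNReal

noncomputable section

namespace SubsamplingKFWER

/-- `k-max (y i : i ∈ K)`: the `k`-th largest of the values `y i`, `i ∈ K`, counted with
multiplicity. It is meant for `1 ≤ k ≤ |K|`. -/
def kMax {ι : Type*} (k : ℕ) (K : Finset ι) (y : ι → ℝ) : ℝ :=
  ((K.val.map y).sort (· ≥ ·)).getD (k - 1) 0

section StepDown

variable {ι : Type*} [Fintype ι] [DecidableEq ι]

/-- The critical value of a later step of the step-down method, when `R` is the set of indices of
the hypotheses rejected so far: the maximum of `c (Rᶜ ∪ I)` over `I ⊆ R` with `|I| = k - 1`. -/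
def stepCritical (k : ℕ) (c : Finset ι → ℝ) (R : Finset ι) (h : k ≤ R.card) : ℝ :=
  (R.powersetCard (k - 1)).sup'
    (Finset.powersetCard_nonempty.2 ((Nat.sub_le k 1).trans h)) (fun I => c (Rᶜ ∪ I))

/-- The first step: reject every hypothesis whose statistic exceeds `c {1, …, s}`. -/
def firstStep (c : Finset ι → ℝ) (t : ι → ℝ) : Finset ι :=
  Finset.univ.filter (fun i => c Finset.univ < t i)

/-- A later step, acting on the set `R` of indices rejected so far. If fewer than `k` hypotheses
have been rejected nothing more is rejected. A set that is left unchanged is where the method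
stops. -/
def laterStep (k : ℕ) (c : Finset ι → ℝ) (t : ι → ℝ) (R : Finset ι) : Finset ι :=
  if h : k ≤ R.card then
    R ∪ Rᶜ.filter (fun i => stepCritical k c R h < t i)
  else R

/-- The set of indices rejected by the generic step-down method with test statistics `t` and
critical values `c K`. Each step before the method stops rejects at least one more hypothesis, so
that the method has stopped after as many later steps as there are hypotheses. -/
def stepDown (k : ℕ) (c : Finset ι → ℝ) (t : ι → ℝ) : Finset ι :=
  (laterStep k c t)^[Fintype.card ι] (firstStep c t)

end StepDown

section Laws

variable {𝒳 : Type*} [MeasurableSpace 𝒳] {s : ℕ}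

/-- `I(P)`: the indices of the true hypotheses, `H i` being the set of the probability
distributions that satisfy the `i`-th hypothesis. -/
def trueNulls (H : Fin s → Set (ProbabilityMeasure 𝒳)) (P : ProbabilityMeasure 𝒳) :
    Finset (Fin s) :=
  open Classical in Finset.univ.filter (fun i => P ∈ H i)

/-- `G_{n,K}(P)`: the joint distribution of the statistics `T n i`, `i ∈ K`, evaluated at
`n` independent observations from `P`. -/
def jointLaw (T : (n : ℕ) → Fin s → (Fin n → 𝒳) → ℝ) (hT : ∀ n i, Measurable (T n i))
    (P : ProbabilityMeasure 𝒳) (n : ℕ) (K : Finset (Fin s)) : ProbabilityMeasure (K → ℝ) :=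
  ⟨(Measure.pi (fun _ : Fin n => (P : Measure 𝒳))).map (fun x (i : K) => T n i x),
    Measure.isProbabilityMeasure_map
      (measurable_pi_lambda _ (fun i : K => hT n i)).aemeasurable⟩

/-- The c.d.f. at `x` of the `k`-max of a random vector with joint distribution `G`. -/
def kMaxCdf {K : Finset (Fin s)} (G : ProbabilityMeasure (K → ℝ)) (k : ℕ) (x : ℝ) : ℝ :=
  (G : Measure (K → ℝ)).real {y | kMax k Finset.univ y ≤ x}

/-- The `p`-quantile of the `k`-max of a random vector with joint distribution `G`. -/
def kMaxQuantile {K : Finset (Fin s)} (G : ProbabilityMeasure (K → ℝ)) (k : ℕ) (p : ℝ) : ℝ :=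
  sInf {x : ℝ | p ≤ kMaxCdf G k x}

/-- The statistics `T n i`, `i ∈ K`, have the joint limit law `G`, and the c.d.f. of the `k`-max
under `G` is continuous and strictly increasing at its `1 - α` quantile. The `k`-max of the limit
makes sense when `k ≤ |K|`; otherwise nothing is assumed about it. -/
structure AssumptionS (T : (n : ℕ) → Fin s → (Fin n → 𝒳) → ℝ) (hT : ∀ n i, Measurable (T n i))
    (P : ProbabilityMeasure 𝒳) (K : Finset (Fin s)) (k : ℕ) (α : ℝ)
    (G : ProbabilityMeasure (K → ℝ)) : Prop where
  tendsto_jointLaw : Tendsto (fun n => jointLaw T hT P n K) atTop (𝓝 G)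
  continuousAt_cdf : k ≤ K.card → ContinuousAt (kMaxCdf G k) (kMaxQuantile G k (1 - α))
  cdf_lt_left : k ≤ K.card → ∀ x < kMaxQuantile G k (1 - α),
    kMaxCdf G k x < kMaxCdf G k (kMaxQuantile G k (1 - α))
  cdf_lt_right : k ≤ K.card → ∀ x > kMaxQuantile G k (1 - α),
    kMaxCdf G k (kMaxQuantile G k (1 - α)) < kMaxCdf G k x

end Laws

section Subsampling

variable {𝒳 : Type*} {s : ℕ}

/-- The statistic `T b i` evaluated at the subsample of `x` with index set `a`, where `|a| = b`;
the observations are kept in their original order. -/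
def subStat (T : (n : ℕ) → Fin s → (Fin n → 𝒳) → ℝ) (b : ℕ) {n : ℕ} (x : Fin n → 𝒳)
    (a : {a : Finset (Fin n) // a.card = b}) (i : Fin s) : ℝ :=
  T b i (fun j => x (a.1.orderEmbOfFin a.2 j))

/-- The empirical distribution of the `n.choose b` vectors of subsample statistics with indices
in `K`. -/
def subMeasure (T : (n : ℕ) → Fin s → (Fin n → 𝒳) → ℝ) (b : ℕ) {n : ℕ} (x : Fin n → 𝒳)
    (K : Finset (Fin s)) : Measure (K → ℝ) :=
  (n.choose b : ℝ≥0∞)⁻¹ • ∑ a : {a : Finset (Fin n) // a.card = b},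
    Measure.dirac (fun i : K => subStat T b x a i)

theorem isProbabilityMeasure_subMeasure (T : (n : ℕ) → Fin s → (Fin n → 𝒳) → ℝ) {b n : ℕ}
    (h : b ≤ n) (x : Fin n → 𝒳) (K : Finset (Fin s)) :
    IsProbabilityMeasure (subMeasure T b x K) := by
  constructor
  have h0 : (n.choose b : ℝ≥0∞) ≠ 0 := by
    exact_mod_cast (Nat.choose_pos h).ne'
  simp [subMeasure, Measure.finsetSum_apply, Fintype.card_finset_len,
    ENNReal.inv_mul_cancel h0 (ENNReal.natCast_ne_top _)]

/-- The subsampling estimate of the joint distribution. There are no subsamples when `n < b`, and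
the value is then irrelevant. -/
def subLaw (T : (n : ℕ) → Fin s → (Fin n → 𝒳) → ℝ) (b : ℕ) {n : ℕ} (x : Fin n → 𝒳)
    (K : Finset (Fin s)) : ProbabilityMeasure (K → ℝ) :=
  if h : b ≤ n then ⟨subMeasure T b x K, isProbabilityMeasure_subMeasure T h x K⟩
  else ⟨Measure.dirac 0, inferInstance⟩

/-- The subsampling estimate of the c.d.f. of the `k`-max of the statistics with indices in `K`. -/
def subCdf (T : (n : ℕ) → Fin s → (Fin n → 𝒳) → ℝ) (b : ℕ) {n : ℕ} (x : Fin n → 𝒳)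
    (K : Finset (Fin s)) (k : ℕ) (u : ℝ) : ℝ :=
  (n.choose b : ℝ)⁻¹ * ∑ a : {a : Finset (Fin n) // a.card = b},
    if kMax k K (subStat T b x a) ≤ u then 1 else 0

/-- The subsampling critical value: the `p`-quantile of the estimated distribution of the
`k`-max. -/
def subQuantile (T : (n : ℕ) → Fin s → (Fin n → 𝒳) → ℝ) (b : ℕ) {n : ℕ} (x : Fin n → 𝒳)
    (k : ℕ) (p : ℝ) (K : Finset (Fin s)) : ℝ :=
  sInf {u : ℝ | p ≤ subCdf T b x K k u}

end Subsampling

/-- The first `n` observations. -/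
def sample {Ω 𝒳 : Type*} (X : ℕ → Ω → 𝒳) (n : ℕ) (ω : Ω) : Fin n → 𝒳 := fun j => X j ω

/-- The metric `ρ` on the probability distributions on `E` metrizes weak convergence. -/
def MetrizesWeakConvergence {E : Type*} [TopologicalSpace E] [MeasurableSpace E]
    [OpensMeasurableSpace E] (ρ : MetricSpace (ProbabilityMeasure E)) : Prop :=
  ρ.toPseudoMetricSpace.toUniformSpace.toTopologicalSpace =
    (inferInstance : TopologicalSpace (ProbabilityMeasure E))

end SubsamplingKFWER

end

namespace SubsamplingKFWER

/-! Integrating a bounded continuous `f` against the subsampling law gives a U-statistic of order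
`b`, whose mean is the integral of `f` against `G_{b,K}(P)`. Hoeffding's device writes it as an
average, over permutations, of means over `n / b` disjoint blocks. Its variance is thus O(b/n)
(`mul_integral_sq_uStatistic_le`), and Chebyshev gives weak convergence in probability
(`tendsto_subLaw`). Convergence in probability is treated as convergence along the filter
`inProbability`, so the portmanteau theorem and continuity of a metric apply directly, without
subsequences. Quantile consistency (`tendsto_kMaxQuantile`) is therefore proved along an arbitrary
filter. Error control rests on a deterministic fact, `le_card_filter_of_le_card_stepDown_inter`:
critical values grow with the index set, so `k` false rejections force the `k`-max over the true
hypotheses above the critical value of that set alone. The latter is consistent, and portmanteau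
bounds the limiting probability by `α`. -/

theorem getElem_iff_lt_countP_of_pairwise_ge {l : List ℝ} (hl : l.Pairwise (· ≥ ·))
    (p : ℝ → Prop) [DecidablePred p] (hp : Monotone p) (j : ℕ) (hj : j < l.length) :
    p l[j] ↔ j < l.countP (fun x => decide (p x)) := by
  induction l generalizing j with
  | nil => simp at hj
  | cons a l ih =>
    rw [List.pairwise_cons] at hl
    by_cases ha : p a
    · cases j with
      | zero => simp [ha]
      | succ j =>
        simp only [List.getElem_cons_succ, List.countP_cons, ha, decide_true, if_true]
        rw [ih hl.2 j (by simpa using hj)]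
        omega
    -- In a decreasing list the entries satisfying an upward closed `p` form an initial segment, so
    -- failure at the head means failure throughout.
    · have hall : ∀ x ∈ l, ¬ p x := fun x hx h => ha (hp (hl.1 x hx) h)
      have h0 : l.countP (fun x => decide (p x)) = 0 := by
        simpa [List.countP_eq_zero] using hall
      rw [List.countP_cons, h0]
      simp only [ha, decide_false, Bool.false_eq_true, if_false, add_zero, not_lt_zero, iff_false]
      cases j with
      | zero => simpa using ha
      | succ j => exact hall _ (List.getElem_mem _)

/-! ### Order statistics: counting, monotonicity, continuity -/

section KMax

variable {ι : Type*} {k : ℕ} {K : Finset ι}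

/-- A general upward closed `p` serves the strict and the weak inequality at once. -/
theorem pred_kMax_iff (hk : 1 ≤ k) (hK : k ≤ K.card) (y : ι → ℝ)
    (p : ℝ → Prop) [DecidablePred p] (hp : Monotone p) :
    p (kMax k K y) ↔ k ≤ (K.filter (fun i => p (y i))).card := by
  have hlen : k - 1 < ((K.val.map y).sort (· ≥ ·)).length := by
    rw [Multiset.length_sort, Multiset.card_map, Finset.card_val]; omega
  have hcount : ((K.val.map y).sort (· ≥ ·)).countP (fun x => decide (p x))
      = (K.filter (fun i => p (y i))).card := by
    rw [← Multiset.coe_countP, Multiset.sort_eq, Multiset.countP_map]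
    rfl
  rw [kMax, List.getD_eq_getElem _ _ hlen,
    getElem_iff_lt_countP_of_pairwise_ge (Multiset.pairwise_sort _ _) p hp, hcount]
  omega

theorem lt_kMax_iff (hk : 1 ≤ k) (hK : k ≤ K.card) (y : ι → ℝ) (u : ℝ) :
    u < kMax k K y ↔ k ≤ (K.filter (fun i => u < y i)).card :=
  pred_kMax_iff hk hK y (u < ·) fun _ _ h h' => lt_of_lt_of_le h' h

theorem le_kMax_iff (hk : 1 ≤ k) (hK : k ≤ K.card) (y : ι → ℝ) (u : ℝ) :
    u ≤ kMax k K y ↔ k ≤ (K.filter (fun i => u ≤ y i)).card :=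
  pred_kMax_iff hk hK y (u ≤ ·) fun _ _ h h' => le_trans h' h

theorem kMax_mono_set (hk : 1 ≤ k) (hK : k ≤ K.card) {K' : Finset ι} (h : K ⊆ K') (y : ι → ℝ) :
    kMax k K y ≤ kMax k K' y := by
  rw [le_kMax_iff hk (hK.trans (Finset.card_le_card h))]
  exact ((le_kMax_iff hk hK y _).1 le_rfl).trans
    (Finset.card_le_card (Finset.filter_subset_filter _ h))

theorem kMax_univ_coe (K : Finset ι) (y : ι → ℝ) :
    kMax k (Finset.univ : Finset K) (fun i : K => y i) = kMax k K y := by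
  have : (Finset.univ : Finset K).val.map (fun i : K => y i) = K.val.map y := by
    rw [Finset.univ_eq_attach, Finset.attach_val]
    exact Multiset.attach_map_val' K.val y
  rw [kMax, kMax, this]

/-- At least `k` coordinates reach `u` iff all those of some `k`-subset do: a finite union of
intersections of closed half-spaces. -/
theorem isClosed_setOf_le_kMax (hk : 1 ≤ k) (hK : k ≤ K.card) (u : ℝ) :
    IsClosed {y : ι → ℝ | u ≤ kMax k K y} := by
  have : {y : ι → ℝ | u ≤ kMax k K y} =
      ⋃ S ∈ K.powersetCard k, ⋂ i ∈ S, {y : ι → ℝ | u ≤ y i} := by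
    ext y
    simp only [Set.mem_ofPred_eq, le_kMax_iff hk hK, Set.mem_iUnion, Set.mem_iInter,
      Finset.mem_powersetCard, exists_prop]
    constructor
    · intro h
      obtain ⟨S, hS, hc⟩ := Finset.exists_subset_card_eq h
      exact ⟨S, ⟨hS.trans (Finset.filter_subset _ _), hc⟩, fun i hi => (Finset.mem_filter.1 (hS hi)).2⟩
    · rintro ⟨S, ⟨hS, rfl⟩, h⟩
      exact Finset.card_le_card fun i hi => Finset.mem_filter.2 ⟨hS hi, h i hi⟩
  rw [this]
  exact Set.Finite.isClosed_biUnion (Finset.finite_toSet _) fun S _ =>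
    isClosed_biInter fun i _ => isClosed_le continuous_const (continuous_apply i)

theorem isOpen_setOf_lt_kMax (hk : 1 ≤ k) (hK : k ≤ K.card) (u : ℝ) :
    IsOpen {y : ι → ℝ | u < kMax k K y} := by
  have : {y : ι → ℝ | u < kMax k K y} =
      ⋃ S ∈ K.powersetCard k, ⋂ i ∈ S, {y : ι → ℝ | u < y i} := by
    ext y
    simp only [Set.mem_ofPred_eq, lt_kMax_iff hk hK, Set.mem_iUnion, Set.mem_iInter,
      Finset.mem_powersetCard, exists_prop]
    constructor
    · intro h
      obtain ⟨S, hS, hc⟩ := Finset.exists_subset_card_eq h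
      exact ⟨S, ⟨hS.trans (Finset.filter_subset _ _), hc⟩, fun i hi => (Finset.mem_filter.1 (hS hi)).2⟩
    · rintro ⟨S, ⟨hS, rfl⟩, h⟩
      exact Finset.card_le_card fun i hi => Finset.mem_filter.2 ⟨hS hi, h i hi⟩
  rw [this]
  exact isOpen_biUnion fun S _ =>
    isOpen_biInter_finset fun i _ => isOpen_lt continuous_const (continuous_apply i)

theorem continuous_kMax (hk : 1 ≤ k) (hK : k ≤ K.card) :
    Continuous (fun y : ι → ℝ => kMax k K y) := by
  rw [continuous_iff_lower_upperSemicontinuous, lowerSemicontinuous_iff_isOpen_preimage,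
    upperSemicontinuous_iff_isOpen_preimage]
  refine ⟨fun u => isOpen_setOf_lt_kMax hk hK u, fun u => ?_⟩
  rw [← isClosed_compl_iff]
  convert! isClosed_setOf_le_kMax hk hK u using 1
  ext y
  simp

end KMax

/-! ### Deterministic analysis of the step-down method -/

section StepDown

variable {ι : Type*} [Fintype ι] [DecidableEq ι] {k : ℕ} {c : Finset ι → ℝ} {I : Finset ι}

/-- As `R ∩ I` has at most `k - 1` elements, it extends to some `J ⊆ R` of size `k - 1`. Then `Rᶜ ∪
J` contains `I` and competes in the maximum. -/
theorem le_stepCritical (hc : ∀ K, I ⊆ K → c I ≤ c K) {R : Finset ι}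
    (h : k ≤ R.card) (hR : (R ∩ I).card < k) : c I ≤ stepCritical k c R h := by
  obtain ⟨J, hJ, hJR, hcard⟩ := Finset.exists_subsuperset_card_eq
    (Finset.inter_subset_left : R ∩ I ⊆ R) (Nat.le_sub_one_of_lt hR) ((Nat.sub_le k 1).trans h)
  refine (hc (Rᶜ ∪ J) fun i hi => ?_).trans
    (Finset.le_sup' (fun J => c (Rᶜ ∪ J)) (Finset.mem_powersetCard.2 ⟨hJR, hcard⟩))
  by_cases hiR : i ∈ R
  · exact Finset.mem_union_right _ (hJ (Finset.mem_inter.2 ⟨hiR, hi⟩))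
  · exact Finset.mem_union_left _ (Finset.mem_compl.2 hiR)

/-- If the critical value of `I` is at most that of every larger set, then the step-down method
rejects at least `k` elements of `I` only when at least `k` of their statistics exceed `c I`. -/
theorem le_card_filter_of_le_card_stepDown_inter
    (hc : ∀ K, I ⊆ K → c I ≤ c K) (t : ι → ℝ) (h : k ≤ (stepDown k c t ∩ I).card) :
    k ≤ (I.filter (fun i => c I < t i)).card := by
  by_contra hlt
  -- The invariant sustains itself: by `hlt` it leaves fewer than `k` rejected elements of `I`,
  -- which is what `le_stepCritical` needs at the next step.
  have key : ∀ m : ℕ, (laterStep k c t)^[m] (firstStep c t) ∩ I ⊆ I.filter (fun i => c I < t i) := by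
    intro m
    induction m with
    | zero =>
      intro i hi
      simp only [Function.iterate_zero, id, firstStep, Finset.mem_inter, Finset.mem_filter,
        Finset.mem_univ, true_and] at hi
      exact Finset.mem_filter.2 ⟨hi.2, (hc _ (Finset.subset_univ _)).trans_lt hi.1⟩
    | succ m ih =>
      rw [Function.iterate_succ_apply']
      set R := (laterStep k c t)^[m] (firstStep c t)
      rw [laterStep]
      split_ifs with hR
      · intro i hi
        rw [Finset.mem_inter, Finset.mem_union, Finset.mem_filter] at hi
        obtain ⟨hi | hi, hiI⟩ := hi
        · exact ih (Finset.mem_inter.2 ⟨hi, hiI⟩)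
        · exact Finset.mem_filter.2 ⟨hiI, (le_stepCritical hc hR
            ((Finset.card_le_card ih).trans_lt (not_le.1 hlt))).trans_lt hi.2⟩
      · exact ih
  exact hlt (h.trans (Finset.card_le_card (key _)))

end StepDown

/-! ### Averaging over permutations -/

section Permutations

variable {n b : ℕ}

/-- The image under a permutation of a set of given size. -/
def permImage (σ : Equiv.Perm (Fin n)) (a : {a : Finset (Fin n) // a.card = b}) :
    {a : Finset (Fin n) // a.card = b} :=
  ⟨a.1.map σ.toEmbedding, by rw [Finset.card_map, a.2]⟩

theorem permImage_mul (σ τ : Equiv.Perm (Fin n)) (a : {a : Finset (Fin n) // a.card = b}) :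
    permImage (σ * τ) a = permImage σ (permImage τ a) := by
  apply Subtype.ext
  simp only [permImage, Finset.map_map]
  rfl

theorem permImage_bijective (σ : Equiv.Perm (Fin n)) :
    Function.Bijective (permImage (b := b) σ) := by
  refine Finite.injective_iff_bijective.1 fun a a' h => Subtype.ext ?_
  exact Finset.map_injective _ (congrArg Subtype.val h)

theorem exists_permImage_eq (a a' : {a : Finset (Fin n) // a.card = b}) :
    ∃ σ : Equiv.Perm (Fin n), permImage σ a = a' := by
  let e : {x // x ∈ a.1} ≃ {x // x ∈ a'.1} := Finset.equivOfCardEq (a.2.trans a'.2.symm)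
  refine ⟨e.extendSubtype, Subtype.ext (Finset.eq_of_subset_of_card_le (fun x hx => ?_) ?_)⟩
  · obtain ⟨y, hy, rfl⟩ := Finset.mem_map.1 hx
    exact e.extendSubtype_mem y hy
  · rw [a'.2, (permImage _ a).2]

/-- The average over all permutations of a function of the image of a fixed set is the average of
the function over all sets of the same size. -/
theorem choose_mul_sum_permImage (g : {a : Finset (Fin n) // a.card = b} → ℝ)
    (B : {a : Finset (Fin n) // a.card = b}) :
    (n.choose b : ℝ) * ∑ σ : Equiv.Perm (Fin n), g (permImage σ B) =
      (Fintype.card (Equiv.Perm (Fin n)) : ℝ) * ∑ a, g a := by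
  -- Permutations act transitively on sets of size `b`, and right translation reindexes the sum.
  have hconst : ∀ a, ∑ σ : Equiv.Perm (Fin n), g (permImage σ a) =
      ∑ σ : Equiv.Perm (Fin n), g (permImage σ B) := by
    intro a
    obtain ⟨τ, rfl⟩ := exists_permImage_eq B a
    simp_rw [← permImage_mul]
    exact Equiv.sum_comp (Equiv.mulRight τ) (fun σ => g (permImage σ B))
  have hcard : Fintype.card {a : Finset (Fin n) // a.card = b} = n.choose b := by
    rw [Fintype.card_finset_len, Fintype.card_fin]
  have h1 : ∑ a : {a : Finset (Fin n) // a.card = b}, ∑ σ : Equiv.Perm (Fin n),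
      g (permImage σ a) = (n.choose b : ℝ) * ∑ σ : Equiv.Perm (Fin n), g (permImage σ B) := by
    rw [Finset.sum_congr rfl fun a _ => hconst a, Finset.sum_const, Finset.card_univ, hcard,
      nsmul_eq_mul]
  rw [← h1, Finset.sum_comm, Finset.sum_congr rfl fun σ _ =>
    (permImage_bijective (b := b) σ).sum_comp g, Finset.sum_const, Finset.card_univ, nsmul_eq_mul]

theorem exists_disjoint_blocks {m : ℕ} (h : m * b ≤ n) :
    ∃ B : Fin m → {a : Finset (Fin n) // a.card = b},
      ∀ i j, i ≠ j → Disjoint (B i).1 (B j).1 := by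
  let f : Fin m × Fin b → Fin n := fun p => Fin.castLE h (finProdFinEquiv p)
  have hf : Function.Injective f :=
    (Fin.castLE_injective h).comp finProdFinEquiv.injective
  refine ⟨fun j => ⟨Finset.univ.map ⟨fun i => f (j, i), fun i i' hi => ?_⟩, by simp⟩, ?_⟩
  · simpa using hf hi
  · intro i j hij
    rw [Finset.disjoint_left]
    intro x hx hx'
    simp only [Finset.mem_map, Finset.mem_univ, true_and] at hx hx'
    obtain ⟨p, rfl⟩ := hx
    obtain ⟨q, hq⟩ := hx'
    exact hij (Prod.ext_iff.1 (hf hq)).1.symm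

end Permutations

/-! ### Hoeffding's variance bound -/

section Variance

variable {Ω : Type*} [MeasurableSpace Ω] {μ : Measure Ω} [IsProbabilityMeasure μ] {n b : ℕ}

/-- A bound on the variance of a complete average over all subsets of size `b`: it is at most what
it would be for an average over `m` disjoint subsets. -/
theorem mul_integral_sq_average_le {m : ℕ} (h : m * b ≤ n) (hbn : b ≤ n)
    (Y : {a : Finset (Fin n) // a.card = b} → Ω → ℝ) {M : ℝ}
    (hY : ∀ a, AEMeasurable (Y a) μ) (hM : ∀ a ω, |Y a ω| ≤ M)
    (horth : ∀ a a', Disjoint a.1 a'.1 → ∫ ω, Y a ω * Y a' ω ∂μ = 0) :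
    (m : ℝ) * ∫ ω, ((n.choose b : ℝ)⁻¹ * ∑ a, Y a ω) ^ 2 ∂μ ≤ M ^ 2 := by
  obtain ⟨B, hB⟩ := exists_disjoint_blocks (b := b) h
  have hN : (n.choose b : ℝ) ≠ 0 := by exact_mod_cast (Nat.choose_pos hbn).ne'
  rcases Nat.eq_zero_or_pos m with rfl | hm
  · simpa using sq_nonneg M
  have hm' : (0 : ℝ) < m := by exact_mod_cast hm
  set Q : ℝ := (Fintype.card (Equiv.Perm (Fin n)) : ℝ) with hQ
  have hQ0 : 0 < Q := by rw [hQ]; exact_mod_cast Fintype.card_pos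
  have hint : ∀ a a', Integrable (fun ω => Y a ω * Y a' ω) μ := fun a a' =>
    Integrable.of_bound ((hY a).mul (hY a')).aestronglyMeasurable (M * M)
      (ae_of_all _ fun ω => by
        rw [norm_mul]
        exact mul_le_mul (hM a ω) (hM a' ω) (norm_nonneg _) ((abs_nonneg _).trans (hM a ω)))
  have hZint : ∀ σ : Equiv.Perm (Fin n),
      Integrable (fun ω => (∑ j, Y (permImage σ (B j)) ω) ^ 2) μ := by
    intro σ
    simp_rw [sq, Finset.sum_mul_sum]
    exact integrable_finsetSum _ fun i _ => integrable_finsetSum _ fun j _ => hint _ _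
  have hZ : ∀ σ : Equiv.Perm (Fin n),
      ∫ ω, (∑ j, Y (permImage σ (B j)) ω) ^ 2 ∂μ ≤ m * M ^ 2 := by
    intro σ
    simp_rw [sq, Finset.sum_mul_sum]
    rw [integral_finsetSum _ fun i _ => integrable_finsetSum _ fun j _ => hint _ _]
    -- A permutation keeps the blocks disjoint, so only the diagonal term survives.
    have hle : ∀ i : Fin m, ∫ ω, ∑ j, Y (permImage σ (B i)) ω * Y (permImage σ (B j)) ω ∂μ
        ≤ M * M := by
      intro i
      rw [integral_finsetSum _ fun j _ => hint _ _, Finset.sum_eq_single i]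
      · refine (integral_mono (hint _ _) (integrable_const (M * M)) fun ω => ?_).trans_eq (by simp)
        exact (abs_mul_abs_self (Y (permImage σ (B i)) ω)).symm.trans_le
          (mul_self_le_mul_self (abs_nonneg _) (hM _ ω))
      · intro j _ hji
        exact horth _ _ ((Finset.disjoint_map _).2 (hB i j hji.symm))
      · simp
    refine (Finset.sum_le_sum fun i _ => hle i).trans_eq ?_
    simp
  -- The complete average is the mean over permutations of block averages; Cauchy–Schwarz moves the
  -- square inside.
  have hpt : ∀ ω, ((n.choose b : ℝ)⁻¹ * ∑ a, Y a ω) ^ 2 ≤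
      (m ^ 2 * Q)⁻¹ * ∑ σ : Equiv.Perm (Fin n), (∑ j, Y (permImage σ (B j)) ω) ^ 2 := by
    intro ω
    have h1 : (n.choose b : ℝ) * ∑ σ : Equiv.Perm (Fin n), ∑ j, Y (permImage σ (B j)) ω =
        m * (Q * ∑ a, Y a ω) := by
      rw [Finset.sum_comm, Finset.mul_sum, Finset.sum_congr rfl fun j _ =>
        choose_mul_sum_permImage (fun a => Y a ω) (B j)]
      simp [hQ]
    have h2 : (n.choose b : ℝ)⁻¹ * ∑ a, Y a ω =
        (m * Q)⁻¹ * ∑ σ : Equiv.Perm (Fin n), ∑ j, Y (permImage σ (B j)) ω := by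
      field_simp
      linarith
    have h3 := sq_sum_le_card_mul_sum_sq (s := (Finset.univ : Finset (Equiv.Perm (Fin n))))
      (f := fun σ => ∑ j, Y (permImage σ (B j)) ω)
    rw [Finset.card_univ, ← hQ] at h3
    rw [h2, mul_pow]
    refine (mul_le_mul_of_nonneg_left h3 (by positivity)).trans_eq ?_
    field_simp
  have hmain : ∫ ω, ((n.choose b : ℝ)⁻¹ * ∑ a, Y a ω) ^ 2 ∂μ ≤
      (m ^ 2 * Q)⁻¹ * (Q * (m * M ^ 2)) := by
    refine (integral_mono_of_nonneg (ae_of_all _ fun ω => sq_nonneg _)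
      ((integrable_finsetSum _ fun σ _ => hZint σ).const_mul _) (ae_of_all _ hpt)).trans ?_
    rw [integral_const_mul, integral_finsetSum _ fun σ _ => hZint σ]
    refine mul_le_mul_of_nonneg_left ?_ (by positivity)
    refine (Finset.sum_le_sum fun σ _ => hZ σ).trans_eq ?_
    rw [Finset.sum_const, Finset.card_univ, nsmul_eq_mul]
  refine (mul_le_mul_of_nonneg_left hmain hm'.le).trans_eq ?_
  field_simp

end Variance

/-! ### U-statistics of independent observations -/

section UStatistic

variable {Ω 𝒳 : Type*} [MeasurableSpace Ω] [MeasurableSpace 𝒳] {μ : Measure Ω}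
  {P : Measure 𝒳} {n b : ℕ} {ξ : Fin n → Ω → 𝒳}

theorem hasLaw_subsample (hlaw : ∀ j, HasLaw (ξ j) P μ) (hindep : iIndepFun ξ μ)
    (a : {a : Finset (Fin n) // a.card = b}) :
    HasLaw (fun ω j => ξ (a.1.orderEmbOfFin a.2 j) ω) (Measure.pi fun _ : Fin b => P) μ :=
  (hindep.precomp (a.1.orderEmbOfFin a.2).injective).hasLaw_pi fun _ => hlaw _

theorem indepFun_subsample (hξ : ∀ j, AEMeasurable (ξ j) μ) (hindep : iIndepFun ξ μ)
    {a a' : {a : Finset (Fin n) // a.card = b}} (h : Disjoint a.1 a'.1) :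
    IndepFun (fun ω j => ξ (a.1.orderEmbOfFin a.2 j) ω)
      (fun ω j => ξ (a'.1.orderEmbOfFin a'.2 j) ω) μ := by
  have hr : ∀ a : {a : Finset (Fin n) // a.card = b}, Measurable
      (fun (x : a.1 → 𝒳) (j : Fin b) => x ⟨a.1.orderEmbOfFin a.2 j, a.1.orderEmbOfFin_mem a.2 j⟩) :=
    fun a => measurable_pi_lambda _ fun j => measurable_pi_apply _
  exact (hindep.indepFun_finset₀ a.1 a'.1 h hξ).comp (hr a) (hr a')

/-- The mean squared error of a U-statistic with a bounded kernel, not necessarily symmetric. -/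
theorem mul_integral_sq_uStatistic_le [IsProbabilityMeasure μ] {m : ℕ} (h : m * b ≤ n) (hbn : b ≤ n)
    (hlaw : ∀ j, HasLaw (ξ j) P μ) (hindep : iIndepFun ξ μ)
    {φ : (Fin b → 𝒳) → ℝ} (hφ : Measurable φ) {M : ℝ} (hM : ∀ x, |φ x| ≤ M) :
    (m : ℝ) * ∫ ω, ((n.choose b : ℝ)⁻¹ * ∑ a : {a : Finset (Fin n) // a.card = b},
      φ (fun j => ξ (a.1.orderEmbOfFin a.2 j) ω) -
        ∫ x, φ x ∂(Measure.pi fun _ : Fin b => P)) ^ 2 ∂μ ≤ (2 * M) ^ 2 := by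
  set θ := ∫ x, φ x ∂(Measure.pi fun _ : Fin b => P) with hθ
  have hpi : ∀ a : {a : Finset (Fin n) // a.card = b}, _ := hasLaw_subsample hlaw hindep
  have hmeas : ∀ a : {a : Finset (Fin n) // a.card = b},
      AEMeasurable (fun ω => φ (fun j => ξ (a.1.orderEmbOfFin a.2 j) ω)) μ := fun a =>
    hφ.comp_aemeasurable (hpi a).aemeasurable
  have hint : ∀ a : {a : Finset (Fin n) // a.card = b},
      Integrable (fun ω => φ (fun j => ξ (a.1.orderEmbOfFin a.2 j) ω)) μ := fun a =>
    Integrable.of_bound (hmeas a).aestronglyMeasurable M (ae_of_all _ fun ω => hM _)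
  have hmean : ∀ a : {a : Finset (Fin n) // a.card = b},
      ∫ ω, φ (fun j => ξ (a.1.orderEmbOfFin a.2 j) ω) ∂μ = θ := by
    intro a
    rw [hθ, ← (hpi a).map_eq, integral_map (hpi a).aemeasurable hφ.aestronglyMeasurable]
  have hne : Nonempty {a : Finset (Fin n) // a.card = b} := by
    rw [← Fintype.card_pos_iff, Fintype.card_finset_len, Fintype.card_fin]
    exact Nat.choose_pos hbn
  -- Hence the centred kernel is bounded by `2 * M`.
  have hθM : |θ| ≤ M := by
    obtain ⟨a⟩ := hne
    rw [← hmean a]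
    refine (norm_integral_le_of_norm_le_const (μ := μ) (C := M)
      (f := fun ω => φ (fun j => ξ (a.1.orderEmbOfFin a.2 j) ω)) (ae_of_all _ fun ω => hM _)).trans_eq ?_
    simp
  have hN : (n.choose b : ℝ) ≠ 0 := by exact_mod_cast (Nat.choose_pos hbn).ne'
  have hcenter : ∀ ω, (n.choose b : ℝ)⁻¹ * ∑ a : {a : Finset (Fin n) // a.card = b},
      φ (fun j => ξ (a.1.orderEmbOfFin a.2 j) ω) - θ =
      (n.choose b : ℝ)⁻¹ * ∑ a : {a : Finset (Fin n) // a.card = b},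
      (φ (fun j => ξ (a.1.orderEmbOfFin a.2 j) ω) - θ) := by
    intro ω
    rw [Finset.sum_sub_distrib, Finset.sum_const, Finset.card_univ, Fintype.card_finset_len,
      Fintype.card_fin, nsmul_eq_mul, mul_sub, inv_mul_cancel_left₀ hN]
  simp_rw [hcenter]
  refine mul_integral_sq_average_le h hbn
    (fun a ω => φ (fun j => ξ (a.1.orderEmbOfFin a.2 j) ω) - θ)
    (fun a => (hmeas a).sub_const θ) (fun a ω => ?_) fun a a' haa' => ?_
  · exact (abs_sub _ _).trans (by linarith [hM fun j => ξ (a.1.orderEmbOfFin a.2 j) ω])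
  · have hi := (indepFun_subsample (fun j => (hlaw j).aemeasurable) hindep haa').comp
      (hφ.sub_const θ) (hφ.sub_const θ)
    have := hi.integral_fun_mul_eq_mul_integral
      ((hmeas a).sub_const θ).aestronglyMeasurable ((hmeas a').sub_const θ).aestronglyMeasurable
    refine this.trans ?_
    have h0 : ∫ ω, (φ (fun j => ξ (a.1.orderEmbOfFin a.2 j) ω) - θ) ∂μ = 0 := by
      rw [integral_sub (hint a) (integrable_const _), hmean a]
      simp
    exact mul_eq_zero_of_left h0 _

end UStatistic

/-! ### Convergence in probability as a filter -/

section InProbability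

variable {Ω : Type*} [MeasurableSpace Ω]

/-- The filter of the sets of pairs `(n, ω)` whose sections have probability tending to one.
Convergence along this filter is convergence in probability. -/
def inProbability (μ : Measure Ω) : Filter (ℕ × Ω) where
  sets := {A | Tendsto (fun n => μ {ω | (n, ω) ∉ A}) atTop (𝓝 0)}
  univ_sets := by simp
  sets_of_superset {A B} hA hAB :=
    tendsto_of_tendsto_of_tendsto_of_le_of_le tendsto_const_nhds hA (fun _ => zero_le)
      fun _ => measure_mono fun _ h h' => h (hAB h')
  inter_sets {A B} hA hB := by
    refine tendsto_of_tendsto_of_tendsto_of_le_of_le tendsto_const_nhds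
      (by simpa using Tendsto.add hA hB) (fun _ => zero_le) fun n => ?_
    refine (measure_mono fun ω h => ?_).trans (measure_union_le _ _)
    exact not_and_or.1 h

variable {μ : Measure Ω}

theorem eventually_inProbability {p : ℕ × Ω → Prop} :
    (∀ᶠ x in inProbability μ, p x) ↔ Tendsto (fun n => μ {ω | ¬ p (n, ω)}) atTop (𝓝 0) :=
  Iff.rfl

theorem tendsto_fst_inProbability : Tendsto Prod.fst (inProbability μ) atTop := by
  intro s hs
  refine tendsto_nhds_of_eventually_eq ?_
  filter_upwards [hs] with n hn
  simp [hn]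

theorem tendstoInMeasure_of_tendsto_inProbability {f : ℕ → Ω → ℝ} {c : ℝ}
    (h : Tendsto (fun x : ℕ × Ω => f x.1 x.2) (inProbability μ) (𝓝 c)) :
    TendstoInMeasure μ f atTop fun _ => c := by
  intro ε hε
  have := eventually_inProbability.1 (h.eventually (Metric.eball_mem_nhds c hε))
  simpa using this

/-- Chebyshev's inequality around a moving centre `θ n`, with mean squared error of order `1 / m n`.
-/
theorem tendsto_inProbability_of_integral_sq [IsFiniteMeasure μ] {f : ℕ → Ω → ℝ} {θ : ℕ → ℝ}
    {c C : ℝ} (hf : ∀ᶠ n in atTop, Integrable (fun ω => (f n ω - θ n) ^ 2) μ)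
    (hθ : Tendsto θ atTop (𝓝 c)) {m : ℕ → ℕ} (hm : Tendsto m atTop atTop)
    (hC : ∀ᶠ n in atTop, m n * ∫ ω, (f n ω - θ n) ^ 2 ∂μ ≤ C) :
    Tendsto (fun x : ℕ × Ω => f x.1 x.2) (inProbability μ) (𝓝 c) := by
  suffices h : Tendsto (fun x : ℕ × Ω => f x.1 x.2 - θ x.1) (inProbability μ) (𝓝 0) by
    simpa using h.add (hθ.comp tendsto_fst_inProbability)
  rw [Metric.tendsto_nhds]
  intro ε hε
  rw [eventually_inProbability]
  have hbound : Tendsto (fun n => ENNReal.ofReal (C / (ε ^ 2) / m n)) atTop (𝓝 0) := by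
    rw [← ENNReal.ofReal_zero]
    exact ENNReal.tendsto_ofReal
      (tendsto_const_nhds.div_atTop (tendsto_natCast_atTop_atTop.comp hm))
  refine tendsto_of_tendsto_of_tendsto_of_le_of_le' tendsto_const_nhds hbound
    (Eventually.of_forall fun _ => zero_le) ?_
  filter_upwards [hf, hC, hm.eventually_gt_atTop 0] with n hfn hCn hmn
  have hset : {ω | ¬ dist (f n ω - θ n) 0 < ε} = {ω | ε ^ 2 ≤ (f n ω - θ n) ^ 2} := by
    ext ω
    simp only [dist_zero_right, Real.norm_eq_abs, not_lt, Set.mem_ofPred_eq]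
    rw [← sq_abs (f n ω - θ n), sq_le_sq₀ hε.le (abs_nonneg _)]
  have hmn' : (0 : ℝ) < m n := by exact_mod_cast hmn
  have hcheb := mul_meas_ge_le_integral_of_nonneg (ae_of_all _ fun ω => sq_nonneg (f n ω - θ n))
    hfn (ε ^ 2)
  rw [hset, ← ofReal_measureReal]
  refine ENNReal.ofReal_le_ofReal ?_
  rw [le_div_iff₀ hmn', le_div_iff₀ (by positivity)]
  calc _ = m n * (ε ^ 2 * μ.real {ω | ε ^ 2 ≤ (f n ω - θ n) ^ 2}) := by ring
    _ ≤ _ := (mul_le_mul_of_nonneg_left hcheb hmn'.le).trans hCn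

end InProbability

/-! ### Quantiles of the `k`-max under weak convergence -/

section Quantile

variable {s : ℕ} {K : Finset (Fin s)} {k : ℕ} {p : ℝ}

theorem continuous_kMax_univ (hk : 1 ≤ k) (hK : k ≤ K.card) :
    Continuous (fun y : K → ℝ => kMax k Finset.univ y) :=
  continuous_kMax hk (by simpa using hK)

theorem kMaxCdf_mono (G : ProbabilityMeasure (K → ℝ)) (k : ℕ) : Monotone (kMaxCdf G k) :=
  fun _ _ h => measureReal_mono fun _ h' => le_trans h' h

/-- Supplies the limits at `±∞`, which make the set defining the quantile nonempty and bounded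
below, so that its `sInf` is a true infimum. -/
theorem kMaxCdf_eq_cdf (hk : 1 ≤ k) (hK : k ≤ K.card) (G : ProbabilityMeasure (K → ℝ)) :
    kMaxCdf G k = cdf ((G : Measure (K → ℝ)).map (fun y => kMax k Finset.univ y)) := by
  have hm := (continuous_kMax_univ hk hK).measurable
  have := Measure.isProbabilityMeasure_map (μ := (G : Measure (K → ℝ))) hm.aemeasurable
  ext x
  rw [cdf_eq_real, map_measureReal_apply hm measurableSet_Iic]
  rfl

theorem nonempty_setOf_le_kMaxCdf (hk : 1 ≤ k) (hK : k ≤ K.card)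
    (G : ProbabilityMeasure (K → ℝ)) (hp : p < 1) : {x | p ≤ kMaxCdf G k x}.Nonempty := by
  rw [kMaxCdf_eq_cdf hk hK]
  exact ((tendsto_cdf_atTop _).eventually (eventually_ge_nhds hp)).exists

theorem bddBelow_setOf_le_kMaxCdf (hk : 1 ≤ k) (hK : k ≤ K.card)
    (G : ProbabilityMeasure (K → ℝ)) (hp : 0 < p) : BddBelow {x | p ≤ kMaxCdf G k x} := by
  obtain ⟨u, hu⟩ : ∃ u, kMaxCdf G k u < p := by
    rw [kMaxCdf_eq_cdf hk hK]
    exact ((tendsto_cdf_atBot _).eventually (eventually_lt_nhds hp)).exists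
  exact ⟨u, fun x hx => le_of_lt ((kMaxCdf_mono G k).reflect_lt (hu.trans_le hx))⟩

theorem kMaxCdf_lt_of_lt_kMaxQuantile (hk : 1 ≤ k) (hK : k ≤ K.card)
    (G : ProbabilityMeasure (K → ℝ)) (hp : 0 < p) {u : ℝ} (hu : u < kMaxQuantile G k p) :
    kMaxCdf G k u < p :=
  not_le.1 fun h => not_le.2 hu (csInf_le (bddBelow_setOf_le_kMaxCdf hk hK G hp) h)

theorem le_kMaxCdf_kMaxQuantile (hk : 1 ≤ k) (hK : k ≤ K.card)
    (G : ProbabilityMeasure (K → ℝ)) (hp : p < 1)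
    (hcont : ContinuousAt (kMaxCdf G k) (kMaxQuantile G k p)) :
    p ≤ kMaxCdf G k (kMaxQuantile G k p) := by
  refine ge_of_tendsto (hcont.tendsto.mono_left (nhdsWithin_le_nhds (s := Set.Ioi (kMaxQuantile G k p)))) ?_
  filter_upwards [self_mem_nhdsWithin] with u hu
  obtain ⟨x, hx, hxu⟩ := exists_lt_of_csInf_lt (nonempty_setOf_le_kMaxCdf hk hK G hp) hu
  exact le_trans hx (kMaxCdf_mono G k hxu.le)

/-- The quantiles of the `k`-max converge along a weakly convergent family, provided that the
limit c.d.f. is continuous and increases to the right at its quantile. -/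
theorem tendsto_kMaxQuantile (hk : 1 ≤ k) (hK : k ≤ K.card) (hp0 : 0 < p) (hp1 : p < 1)
    {γ : Type*} {L : Filter γ} {Gs : γ → ProbabilityMeasure (K → ℝ)}
    {G : ProbabilityMeasure (K → ℝ)} (hG : Tendsto Gs L (𝓝 G))
    (hcont : ContinuousAt (kMaxCdf G k) (kMaxQuantile G k p))
    (hright : ∀ x > kMaxQuantile G k p, kMaxCdf G k (kMaxQuantile G k p) < kMaxCdf G k x) :
    Tendsto (fun i => kMaxQuantile (Gs i) k p) L (𝓝 (kMaxQuantile G k p)) := by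
  have hkc := continuous_kMax_univ hk hK
  rw [tendsto_order]
  constructor
  · intro l hl
    obtain ⟨u, hlu, hu⟩ := exists_between hl
    have hlim : (L.limsup fun i => (Gs i : Measure (K → ℝ)) {y | kMax k Finset.univ y ≤ u})
        < ENNReal.ofReal p := by
      refine (ProbabilityMeasure.limsup_measure_closed_le_of_tendsto hG
        (isClosed_le hkc continuous_const)).trans_lt ?_
      rw [← ofReal_measureReal]
      exact (ENNReal.ofReal_lt_ofReal_iff hp0).2 (kMaxCdf_lt_of_lt_kMaxQuantile hk hK G hp0 hu)
    filter_upwards [eventually_lt_of_limsup_lt hlim] with i hi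
    rw [← ofReal_measureReal, ENNReal.ofReal_lt_ofReal_iff hp0] at hi
    exact hlu.trans_le (le_csInf (nonempty_setOf_le_kMaxCdf hk hK _ hp1) fun x hx =>
      le_of_lt ((kMaxCdf_mono (Gs i) k).reflect_lt (lt_of_lt_of_le hi hx)))
  · intro l hl
    obtain ⟨u, hu, hul⟩ := exists_between hl
    -- Portmanteau from below needs the open set `kMax < u`. It contains `kMax ≤ v`, whose limit
    -- mass exceeds `p` by strict increase to the right.
    obtain ⟨v, hv, hvu⟩ := exists_between hu
    have hlim : ENNReal.ofReal p <
        L.liminf fun i => (Gs i : Measure (K → ℝ)) {y | kMax k Finset.univ y < u} := by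
      refine lt_of_lt_of_le ?_ (ProbabilityMeasure.le_liminf_measure_open_of_tendsto hG
        (isOpen_lt hkc continuous_const))
      have hsub : {y : K → ℝ | kMax k Finset.univ y ≤ v} ⊆ {y | kMax k Finset.univ y < u} :=
        fun y hy => lt_of_le_of_lt hy hvu
      refine lt_of_lt_of_le ?_ (measure_mono hsub)
      rw [← ofReal_measureReal, ENNReal.ofReal_lt_ofReal_iff_of_nonneg hp0.le]
      exact (le_kMaxCdf_kMaxQuantile hk hK G hp1 hcont).trans_lt (hright v hv)
    filter_upwards [eventually_lt_of_lt_liminf hlim] with i hi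
    refine (csInf_le (bddBelow_setOf_le_kMaxCdf hk hK _ hp0) ?_).trans_lt hul
    rw [← ofReal_measureReal, ENNReal.ofReal_lt_ofReal_iff_of_nonneg hp0.le] at hi
    exact hi.le.trans (measureReal_mono fun y (hy : _ < u) => hy.le)

end Quantile

/-! ### The subsampling law and its critical values -/

section Subsampling

variable {𝒳 : Type*} {s : ℕ} {T : (n : ℕ) → Fin s → (Fin n → 𝒳) → ℝ} {b n : ℕ} {k : ℕ} {p : ℝ}

theorem coe_subLaw (h : b ≤ n) (x : Fin n → 𝒳) (K : Finset (Fin s)) :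
    (subLaw T b x K : Measure (K → ℝ)) = subMeasure T b x K := by
  have : subLaw T b x K = ⟨subMeasure T b x K, isProbabilityMeasure_subMeasure T h x K⟩ :=
    dif_pos h
  rw [this]
  rfl

theorem integral_subLaw (h : b ≤ n) (x : Fin n → 𝒳) (K : Finset (Fin s)) (f : (K → ℝ) → ℝ) :
    ∫ y, f y ∂(subLaw T b x K : Measure (K → ℝ)) = (n.choose b : ℝ)⁻¹ *
      ∑ a : {a : Finset (Fin n) // a.card = b}, f (fun i : K => subStat T b x a i) := by
  rw [coe_subLaw h, subMeasure, integral_smul_measure, integral_finsetSum_measure]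
  · simp
  · intro a _
    exact integrable_dirac (by simp)

theorem kMaxCdf_subLaw (h : b ≤ n) (x : Fin n → 𝒳) {K : Finset (Fin s)} (u : ℝ) :
    kMaxCdf (subLaw T b x K) k u = subCdf T b x K k u := by
  rw [kMaxCdf, coe_subLaw h, subMeasure, subCdf, measureReal_def, Measure.smul_apply,
    Measure.finsetSum_apply, smul_eq_mul, ENNReal.toReal_mul, ENNReal.toReal_sum fun a _ => measure_ne_top _ _]
  congr 1
  · simp
  · refine Finset.sum_congr rfl fun a _ => ?_
    rw [Measure.dirac_apply]
    simp only [Set.indicator, Set.mem_ofPred_eq, kMax_univ_coe K (subStat T b x a), Pi.one_apply]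
    split_ifs <;> simp

theorem kMaxQuantile_subLaw (h : b ≤ n) (x : Fin n → 𝒳) (K : Finset (Fin s)) :
    kMaxQuantile (subLaw T b x K) k p = subQuantile T b x k p K := by
  simp only [kMaxQuantile, subQuantile, kMaxCdf_subLaw h]

theorem subCdf_antitone_set (hk : 1 ≤ k) {K K' : Finset (Fin s)} (hK : k ≤ K.card)
    (hKK' : K ⊆ K') (x : Fin n → 𝒳) (u : ℝ) : subCdf T b x K' k u ≤ subCdf T b x K k u := by
  refine mul_le_mul_of_nonneg_left (Finset.sum_le_sum fun a _ => ?_) (by positivity)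
  have := kMax_mono_set hk hK hKK' (subStat T b x a)
  split_ifs <;> first | (exfalso; linarith) | norm_num

/-- Enlarging the set raises every subsample `k`-max and so lowers the c.d.f. This is the
monotonicity the step-down argument requires. -/
theorem subQuantile_mono_set (hk : 1 ≤ k) (hp0 : 0 < p) (hp1 : p < 1) (h : b ≤ n)
    {K K' : Finset (Fin s)} (hK : k ≤ K.card) (hKK' : K ⊆ K') (x : Fin n → 𝒳) :
    subQuantile T b x k p K ≤ subQuantile T b x k p K' := by
  have hbdd := bddBelow_setOf_le_kMaxCdf hk hK (subLaw T b x K) hp0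
  have hne := nonempty_setOf_le_kMaxCdf hk (hK.trans (Finset.card_le_card hKK'))
    (subLaw T b x K') hp1
  simp only [kMaxCdf_subLaw h] at hbdd hne
  exact csInf_le_csInf hbdd hne fun u hu => le_trans hu (subCdf_antitone_set hk hK hKK' x u)

end Subsampling

theorem eventually_le_of_tendsto_div {b : ℕ → ℕ}
    (hbn : Tendsto (fun n => (b n : ℝ) / (n : ℝ)) atTop (𝓝 0)) (C : ℕ) :
    ∀ᶠ n in atTop, C * b n ≤ n := by
  have hC : (0 : ℝ) < ((C : ℝ) + 1)⁻¹ := by positivity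
  filter_upwards [hbn.eventually (eventually_lt_nhds hC), eventually_gt_atTop 0] with n hn hn0
  have hn0' : (0 : ℝ) < n := by exact_mod_cast hn0
  rw [div_lt_iff₀ hn0', inv_mul_eq_div, lt_div_iff₀ (by positivity)] at hn
  have : (C : ℝ) * b n ≤ n := by nlinarith [(Nat.cast_nonneg (b n) : (0 : ℝ) ≤ b n)]
  exact_mod_cast this

theorem tendsto_div_atTop_of_tendsto_div {b : ℕ → ℕ} (hb : Tendsto b atTop atTop)
    (hbn : Tendsto (fun n => (b n : ℝ) / (n : ℝ)) atTop (𝓝 0)) :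
    Tendsto (fun n => n / b n) atTop atTop := by
  refine tendsto_atTop.2 fun C => ?_
  filter_upwards [eventually_le_of_tendsto_div hbn C, hb.eventually_gt_atTop 0] with n hn hb0
  exact (Nat.le_div_iff_mul_le hb0).2 hn

/-! ### Consistency and asymptotic error control -/

section Consistency

variable {Ω 𝒳 : Type*} [MeasurableSpace Ω] [MeasurableSpace 𝒳] {μ : Measure Ω}
  {P : ProbabilityMeasure 𝒳} {X : ℕ → Ω → 𝒳} {s : ℕ}
  {T : (n : ℕ) → Fin s → (Fin n → 𝒳) → ℝ}

theorem hasLaw_sample (hlaw : ∀ j, HasLaw (X j) (P : Measure 𝒳) μ) (hindep : iIndepFun X μ)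
    (n : ℕ) : HasLaw (sample X n) (Measure.pi fun _ : Fin n => (P : Measure 𝒳)) μ :=
  (hindep.precomp (g := fun j : Fin n => (j : ℕ)) Fin.val_injective).hasLaw_pi fun _ => hlaw _

/-- Consistency of subsampling: the empirical distribution of the subsample statistics converges
weakly, in probability, to the limit law. -/
theorem tendsto_subLaw [IsProbabilityMeasure μ]
    (hlaw : ∀ j, HasLaw (X j) (P : Measure 𝒳) μ) (hindep : iIndepFun X μ)
    (hT : ∀ n i, Measurable (T n i)) {K : Finset (Fin s)} {G : ProbabilityMeasure (K → ℝ)}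
    (hG : Tendsto (fun n => jointLaw T hT P n K) atTop (𝓝 G))
    {b : ℕ → ℕ} (hb : Tendsto b atTop atTop)
    (hbn : Tendsto (fun n => (b n : ℝ) / (n : ℝ)) atTop (𝓝 0)) :
    Tendsto (fun x : ℕ × Ω => subLaw T (b x.1) (sample X x.1 x.2) K) (inProbability μ) (𝓝 G) := by
  rw [ProbabilityMeasure.tendsto_iff_forall_integral_tendsto] at hG ⊢
  intro f
  have hTm : ∀ n, Measurable (fun (x : Fin n → 𝒳) (i : K) => T n i x) := fun n =>
    measurable_pi_lambda _ fun i => hT n i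
  have hφ : ∀ n, Measurable (fun x : Fin n → 𝒳 => f (fun i : K => T n i x)) := fun n =>
    f.continuous.measurable.comp (hTm n)
  have hle : ∀ᶠ n in atTop, b n ≤ n := by simpa using eventually_le_of_tendsto_div hbn 1
  have hθ : ∀ n, ∫ y, f y ∂(jointLaw T hT P n K : Measure (K → ℝ)) =
      ∫ x, f (fun i : K => T n i x) ∂(Measure.pi fun _ : Fin n => (P : Measure 𝒳)) := fun n =>
    integral_map (hTm n).aemeasurable f.continuous.measurable.aestronglyMeasurable
  -- The centre is the mean under sample size `b n`, convergent as `b → ∞`; the number of blocks `n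
  -- / b n` diverges as `b / n → 0`.
  refine tendsto_inProbability_of_integral_sq (C := (2 * ‖f‖) ^ 2)
    (f := fun n ω => ∫ y, f y ∂(subLaw T (b n) (sample X n ω) K : Measure (K → ℝ)))
    (θ := fun n => ∫ y, f y ∂(jointLaw T hT P (b n) K : Measure (K → ℝ))) ?_ ((hG f).comp hb)
    (tendsto_div_atTop_of_tendsto_div hb hbn) ?_
  · filter_upwards [hle] with n hn
    have hmeas : AEMeasurable
        (fun ω => ∫ y, f y ∂(subLaw T (b n) (sample X n ω) K : Measure (K → ℝ))) μ := by
      simp_rw [integral_subLaw hn]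
      refine AEMeasurable.const_mul (Finset.aemeasurable_fun_sum _ fun a _ => ?_) _
      refine (hφ (b n)).comp_aemeasurable (aemeasurable_pi_lambda _ fun j => ?_)
      exact (hlaw _).aemeasurable
    have hbd : ∀ Q : ProbabilityMeasure (K → ℝ), |∫ y, f y ∂(Q : Measure (K → ℝ))| ≤ ‖f‖ :=
      fun Q => f.norm_integral_le_norm _
    refine Integrable.of_bound ((hmeas.sub_const _).pow_const 2).aestronglyMeasurable
      ((2 * ‖f‖) ^ 2) (ae_of_all _ fun ω => ?_)
    rw [norm_pow]
    refine pow_le_pow_left₀ (norm_nonneg _) ((abs_sub _ _).trans ?_) 2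
    linarith [hbd (subLaw T (b n) (sample X n ω) K), hbd (jointLaw T hT P (b n) K)]
  · filter_upwards [hle] with n hn
    simp_rw [integral_subLaw hn, hθ]
    exact mul_integral_sq_uStatistic_le (ξ := fun j : Fin n => X j) (Nat.div_mul_le_self n (b n)) hn
      (fun j => hlaw j) (hindep.precomp (g := fun j : Fin n => (j : ℕ)) Fin.val_injective)
      (hφ (b n)) (fun x => f.norm_coe_le_norm _)

variable {I : Finset (Fin s)} {k : ℕ} {α : ℝ} {hT : ∀ n i, Measurable (T n i)}
  {G : ProbabilityMeasure (I → ℝ)} {b : ℕ → ℕ}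

/-- Consistency of the subsampling critical value. -/
theorem tendsto_subQuantile [IsProbabilityMeasure μ]
    (hlaw : ∀ j, HasLaw (X j) (P : Measure 𝒳) μ) (hindep : iIndepFun X μ)
    (hk : 1 ≤ k) (hα0 : 0 < α) (hα1 : α < 1) (hS : AssumptionS T hT P I k α G)
    (hb : Tendsto b atTop atTop)
    (hbn : Tendsto (fun n => (b n : ℝ) / (n : ℝ)) atTop (𝓝 0))
    (hkI : k ≤ I.card) :
    Tendsto (fun x : ℕ × Ω => subQuantile T (b x.1) (sample X x.1 x.2) k (1 - α) I)
      (inProbability μ) (𝓝 (kMaxQuantile G k (1 - α))) := by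
  have hp0 : 0 < 1 - α := by linarith
  have hp1 : 1 - α < 1 := by linarith
  have hle : ∀ᶠ n in atTop, b n ≤ n := by simpa using eventually_le_of_tendsto_div hbn 1
  have hsub := tendsto_subLaw hlaw hindep hT hS.tendsto_jointLaw hb hbn
  refine (tendsto_kMaxQuantile hk hkI hp0 hp1 hsub (hS.continuousAt_cdf hkI)
    (hS.cdf_lt_right hkI)).congr' ?_
  filter_upwards [tendsto_fst_inProbability.eventually hle] with x hx
  exact kMaxQuantile_subLaw hx _ _


/-- Asymptotic control of the probability of at least `k` false rejections. -/
theorem limsup_measure_stepDown_le [IsProbabilityMeasure μ]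
    (hlaw : ∀ j, HasLaw (X j) (P : Measure 𝒳) μ) (hindep : iIndepFun X μ)
    (hk : 1 ≤ k) (hα0 : 0 < α) (hα1 : α < 1) (hS : AssumptionS T hT P I k α G)
    (hb : Tendsto b atTop atTop)
    (hbn : Tendsto (fun n => (b n : ℝ) / (n : ℝ)) atTop (𝓝 0)) :
    limsup (fun n => μ {ω | k ≤ (stepDown k
        (subQuantile T (b n) (sample X n ω) k (1 - α))
        (fun i => T n i (sample X n ω)) ∩ I).card}) atTop ≤ ENNReal.ofReal α := by
  have hp0 : 0 < 1 - α := by linarith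
  have hp1 : 1 - α < 1 := by linarith
  have hle : ∀ᶠ n in atTop, b n ≤ n := by simpa using eventually_le_of_tendsto_div hbn 1
  rcases lt_or_ge I.card k with hkI | hkI
  · have : ∀ n, {ω | k ≤ (stepDown k (subQuantile T (b n) (sample X n ω) k (1 - α))
        (fun i => T n i (sample X n ω)) ∩ I).card} = ∅ := fun n => by
      refine Set.eq_empty_of_forall_notMem fun ω h => ?_
      exact absurd (le_trans h (Finset.card_le_card Finset.inter_subset_right)) (not_le.2 hkI)
    simp [this]
  have hquant := tendsto_subQuantile hlaw hindep hk hα0 hα1 hS hb hbn hkI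
  set c := kMaxQuantile G k (1 - α)
  have hkc := continuous_kMax_univ hk hkI
  -- The estimated critical value exceeds any `u < c` with probability tending to one. Choosing `l <
  -- u < c` turns the closed event `u ≤ kMax` into the complement of `kMax ≤ l`.
  have hbound : ∀ l < c, limsup (fun n => μ {ω | k ≤ (stepDown k
      (subQuantile T (b n) (sample X n ω) k (1 - α))
      (fun i => T n i (sample X n ω)) ∩ I).card}) atTop ≤
      ENNReal.ofReal (1 - kMaxCdf G k l) := by
    intro l hl
    obtain ⟨u, hlu, huc⟩ := exists_between hl
    have hlow := eventually_inProbability.1 (hquant.eventually (lt_mem_nhds huc))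
    have hstep : ∀ᶠ n in atTop, μ {ω | k ≤ (stepDown k
        (subQuantile T (b n) (sample X n ω) k (1 - α))
        (fun i => T n i (sample X n ω)) ∩ I).card} ≤
        (jointLaw T hT P n I : Measure (I → ℝ)) {y | u ≤ kMax k Finset.univ y} +
        μ {ω | ¬ u < subQuantile T (b n) (sample X n ω) k (1 - α) I} := by
      filter_upwards [hle] with n hn
      have hTm : Measurable (fun (x : Fin n → 𝒳) (i : I) => T n i x) :=
        measurable_pi_lambda _ fun i => hT n i
      have hlaw' : (jointLaw T hT P n I : Measure (I → ℝ)) {y | u ≤ kMax k Finset.univ y} =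
          μ {ω | u ≤ kMax k I (fun i => T n i (sample X n ω))} := by
        have hcl : MeasurableSet {y : I → ℝ | u ≤ kMax k Finset.univ y} :=
          (isClosed_le continuous_const hkc).measurableSet
        have hs := hasLaw_sample hlaw hindep n
        change ((Measure.pi (fun _ : Fin n => (P : Measure 𝒳))).map
          (fun x (i : I) => T n i x)) _ = _
        rw [Measure.map_apply hTm hcl, ← hs.map_eq,
          Measure.map_apply_of_aemeasurable hs.aemeasurable (hTm hcl)]
        congr 1
        ext ω
        exact iff_of_eq (congrArg (u ≤ ·) (kMax_univ_coe I (fun i => T n i (sample X n ω))))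
      rw [hlaw']
      refine (measure_mono fun ω hω => ?_).trans (measure_union_le _ _)
      by_cases hq : u < subQuantile T (b n) (sample X n ω) k (1 - α) I
      · left
        have := le_card_filter_of_le_card_stepDown_inter (I := I)
          (fun K hK => subQuantile_mono_set hk hp0 hp1 hn hkI hK (sample X n ω)) _ hω
        exact (hq.trans ((lt_kMax_iff hk hkI _ _).2 this)).le
      · exact Or.inr hq
    refine (limsup_le_limsup hstep).trans ?_
    refine (ENNReal.limsup_add_of_right_tendsto_zero hlow _).trans_le ?_
    refine (ProbabilityMeasure.limsup_measure_closed_le_of_tendsto hS.tendsto_jointLaw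
      (isClosed_le continuous_const hkc)).trans ?_
    have hms : MeasurableSet {y : I → ℝ | kMax k Finset.univ y ≤ l} :=
      (isClosed_le hkc continuous_const).measurableSet
    rw [kMaxCdf, ← probReal_compl_eq_one_sub hms, ofReal_measureReal]
    exact measure_mono fun y hy => not_le.2 (lt_of_lt_of_le hlu hy)
  -- Letting `l` increase to `c`, continuity of the limit c.d.f. absorbs the slack.
  have hlim : Tendsto (fun l => ENNReal.ofReal (1 - kMaxCdf G k l)) (𝓝[<] c)
      (𝓝 (ENNReal.ofReal (1 - kMaxCdf G k c))) :=
    ENNReal.tendsto_ofReal (tendsto_const_nhds.sub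
      ((hS.continuousAt_cdf hkI).tendsto.mono_left nhdsWithin_le_nhds))
  refine (ge_of_tendsto hlim ?_).trans (ENNReal.ofReal_le_ofReal ?_)
  · filter_upwards [self_mem_nhdsWithin] with l hl using hbound l hl
  · linarith [le_kMaxCdf_kMaxQuantile hk hkI G hp1 (hS.continuousAt_cdf hkI)]

end Consistency

end SubsamplingKFWER

open SubsamplingKFWER in
theorem theorem3p4 {Ω 𝒳 : Type*} [MeasurableSpace Ω] [MeasurableSpace 𝒳]
    (μ : Measure Ω) [IsProbabilityMeasure μ] (P : ProbabilityMeasure 𝒳)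
    (X : ℕ → Ω → 𝒳) (hlaw : ∀ j, HasLaw (X j) (P : Measure 𝒳) μ) (hindep : iIndepFun X μ)
    {s : ℕ} (H : Fin s → Set (ProbabilityMeasure 𝒳))
    (T : (n : ℕ) → Fin s → (Fin n → 𝒳) → ℝ) (hT : ∀ n i, Measurable (T n i))
    (k : ℕ) (hk : 1 ≤ k) (α : ℝ) (hα0 : 0 < α) (hα1 : α < 1)
    (G : ProbabilityMeasure (trueNulls H P → ℝ))
    (hS : AssumptionS T hT P (trueNulls H P) k α G)
    (b : ℕ → ℕ) (hb : Tendsto b atTop atTop)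
    (hbn : Tendsto (fun n => (b n : ℝ) / (n : ℝ)) atTop (𝓝 0)) :
    (∀ ρ : MetricSpace (ProbabilityMeasure (trueNulls H P → ℝ)),
      MetrizesWeakConvergence ρ →
      TendstoInMeasure μ
        (fun n ω => ρ.dist (subLaw T (b n) (sample X n ω) (trueNulls H P))
          (jointLaw T hT P n (trueNulls H P)))
        atTop (fun _ => (0 : ℝ))) ∧
    (k ≤ (trueNulls H P).card →
      TendstoInMeasure μ
        (fun n ω => subQuantile T (b n) (sample X n ω) k (1 - α) (trueNulls H P))
        atTop (fun _ => kMaxQuantile G k (1 - α))) ∧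
    limsup (fun n => μ {ω | k ≤ (stepDown k
        (subQuantile T (b n) (sample X n ω) k (1 - α))
        (fun i => T n i (sample X n ω)) ∩ trueNulls H P).card}) atTop ≤ ENNReal.ofReal α := by
  refine ⟨fun ρ hρ => ?_, fun hkI => tendstoInMeasure_of_tendsto_inProbability
    (tendsto_subQuantile hlaw hindep hk hα0 hα1 hS hb hbn hkI),
    limsup_measure_stepDown_le hlaw hindep hk hα0 hα1 hS hb hbn⟩
  refine tendstoInMeasure_of_tendsto_inProbability ?_
  have hsub := tendsto_subLaw hlaw hindep hT hS.tendsto_jointLaw hb hbn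
  -- Both laws tend to `G` along the same filter, so their `ρ`-distance tends to that of `G` from
  -- itself.
  have hjoint := hS.tendsto_jointLaw.comp (tendsto_fst_inProbability (μ := μ))
  have hρ' : ρ.toPseudoMetricSpace.toUniformSpace.toTopologicalSpace =
    ProbabilityMeasure.instTopologicalSpace := hρ
  rw [← hρ'] at hsub hjoint
  have := @Filter.Tendsto.dist _ _ ρ.toPseudoMetricSpace _ _ _ _ _ hsub hjoint
  rwa [@dist_self _ ρ.toPseudoMetricSpace] at this
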